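/- For a (discrete) group $G$, a function $\varphi : G \to \mathbf{C}$ is of positive type if $\sum_{i,j=1}^n \lambda_i \overline{\lambda_j}\, \varphi(g_j^{-1} g_i) \ge 0$ for all $n$, all $\lambda_1,\dots,\lambda_n \in \mathbf{C}$ and all $g_1,\dots,g_n \in G$. Let $\mathrm{Tr}(G)$ be the convex set of all functions $\varphi : G \to \mathbf{C}$ of positive type that are central (i.e. $\varphi(gxg^{-1}) = \varphi(x)$ for all $g, x \in G$) and normalized (i.e. $\varphi(e) = 1$), and let $\mathrm{Char}(G)$, the set of characters of $G$, be the set of extreme points of $\mathrm{Tr}(G)$. For functions $\varphi_1 : G_1 \to \mathbf{C}$ and $\varphi_2 : G_2 \to \mathbf{C}$, let $\varphi_1 \otimes \varphi_2 : G_1 \times G_2 \to \mathbf{C}$ be given by $(\varphi_1 \otimes \varphi_2)(x_1, x_2) = \varphi_1(x_1)\varphi_2(x_2)$. **Theorem.** Let $G_1, G_2$ be arbitrary discrete groups. Then $$\mathrm{Char}(G_1 \times G_2) = \{\varphi_1 \otimes \varphi_2 \mid \varphi_1 \in \mathrm{Char}(G_1),\ \varphi_2 \in \mathrm{Char}(G_2)\}.$$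 -/

import Mathlib

open scoped ComplexOrder

namespace GroupTrace

/-- A function `φ : G → ℂ` on a group is of positive type if
`∑ i j, c i * conj (c j) * φ ((g j)⁻¹ * g i)` is a nonnegative real number for all finite families
of complex scalars `c` and group elements `g`. -/
def IsPositiveType {G : Type*} [Group G] (φ : G → ℂ) : Prop :=
  ∀ (n : ℕ) (c : Fin n → ℂ) (g : Fin n → G),
    0 ≤ ∑ i, ∑ j, c i * starRingEnd ℂ (c j) * φ ((g j)⁻¹ * g i)

/-- A trace on `G`: a function of positive type that is central and normalized. -/
structure IsTrace {G : Type*} [Group G] (φ : G → ℂ) : Prop where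
  positiveType : IsPositiveType φ
  central : ∀ g x : G, φ (g * x * g⁻¹) = φ x
  normalized : φ 1 = 1

/-- The convex set `Tr(G)` of traces on the (discrete) group `G`. -/
def Tr (G : Type*) [Group G] : Set (G → ℂ) := {φ | IsTrace φ}

/-- The set `Char(G)` of characters of `G`: the extreme points of `Tr(G)`. -/
def Char (G : Type*) [Group G] : Set (G → ℂ) := (Tr G).extremePoints ℝ

/-- The function `φ₁ ⊗ φ₂` on `X₁ × X₂`. -/
def tensor {X₁ X₂ : Type*} (φ₁ : X₁ → ℂ) (φ₂ : X₂ → ℂ) : X₁ × X₂ → ℂ :=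
  fun x => φ₁ x.1 * φ₂ x.2

end GroupTrace

/-!
The inclusion `⊇` is a domination argument: if `ψ` is a trace with `s ψ ≤ φ₁ ⊗ φ₂` and `b` is a
positive element of the group algebra of `G₂`, then `x ↦ ψ (x, b)` is a central function of positive
type dominated by a multiple of `φ₁`, hence a multiple of `φ₁` (`eq_smul_of_mem_Char`). With
`b = (1 + c y)* (1 + c y)` and `c` running over the fourth roots of unity this gives
`ψ (x, y) = φ₁ x * ψ (1, y)`, and extremality of `φ₂` finishes (`tensor_mem_Char`).

For `⊆` it is enough to show that a character `φ` of `G₁ × G₂` factors as `φ (x, 1) * φ (1, y)`; the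
factors are then characters because `ψ ↦ ψ ⊗ φ₂` is affine and injective and maps traces to traces
(Schur product theorem). In von Neumann algebra language, `G₁` generates a factor `M₁`, and the
conditional expectation of `y ∈ G₂` onto `M₁` is central in `M₁`, hence a scalar. Here this is carried
out by hand in the GNS space of `φ`, with cyclic vector `ξ`. Let `P` be the projection onto the
closed span of `G₁ ξ`. The compressions `P y P` commute with one another (`IsGNS.compress_comm`, by
means of the modular conjugation `g ξ ↦ g⁻¹ ξ`) and with `G₁`. If `A = P b P` with `b` as above, then
`A` and its square root commute with all of these, so that `z ↦ ⟪ξ, z A ξ⟫` is of positive type on the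
whole product (`IsGNS.isPositiveType_of_nonneg`); it is also central. The two functions for `c` and
`-c` add up to `4 φ`, so each of them is a multiple of `φ`, and evaluating on `G₁` gives the
factorization (`eq_tensor_of_mem_Char`).
-/

namespace GroupTrace

open scoped ComplexConjugate InnerProductSpace
open Submodule

/-! ### Functions of positive type -/

section PositiveType

variable {G : Type*} [Group G] {φ ψ : G → ℂ}

theorem IsPositiveType.sum_nonneg (h : IsPositiveType φ) {ι : Type*} [Fintype ι]
    (c : ι → ℂ) (g : ι → G) :
    0 ≤ ∑ i, ∑ j, c i * conj (c j) * φ ((g j)⁻¹ * g i) := by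
  have e := (Fintype.equivFin ι).symm
  have := h _ (c ∘ e) (g ∘ e)
  simp only [Function.comp_apply] at this
  rw [e.sum_comp (fun i => ∑ j, c i * conj (c (e j)) * φ ((g (e j))⁻¹ * g i))] at this
  convert this using 2 with i
  rw [e.sum_comp (fun j => c i * conj (c j) * φ ((g j)⁻¹ * g i))]

theorem IsPositiveType.one_nonneg (h : IsPositiveType φ) : 0 ≤ φ 1 := by
  simpa using h.sum_nonneg (fun _ : Unit => 1) (fun _ => 1)

theorem IsPositiveType.add (h : IsPositiveType φ) (h' : IsPositiveType ψ) :
    IsPositiveType (fun g => φ g + ψ g) := by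
  intro n c g
  simpa only [mul_add, Finset.sum_add_distrib] using add_nonneg (h n c g) (h' n c g)

theorem IsPositiveType.const_mul (h : IsPositiveType φ) {r : ℂ} (hr : 0 ≤ r) :
    IsPositiveType (fun g => r * φ g) := by
  intro n c g
  convert mul_nonneg hr (h n c g) using 1
  simp only [Finset.mul_sum]
  exact Finset.sum_congr rfl fun i _ => Finset.sum_congr rfl fun j _ => by ring

theorem IsPositiveType.comp_monoidHom {G' : Type*} [Group G'] (h : IsPositiveType φ)
    (f : G' →* G) : IsPositiveType (fun g => φ (f g)) := by
  intro n c g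
  simpa using h n c (f ∘ g)

theorem IsPositiveType.map_inv (h : IsPositiveType φ) (g : G) : φ g⁻¹ = conj (φ g) := by
  have h0 := (Complex.nonneg_iff.1 h.one_nonneg).2
  have h1 := (Complex.nonneg_iff.1 (h.sum_nonneg ![1, 1] ![1, g])).2
  have h2 := (Complex.nonneg_iff.1 (h.sum_nonneg ![1, Complex.I] ![1, g])).2
  simp [Fin.sum_univ_two] at h1 h2
  apply Complex.ext <;> simp <;> linarith

/-- A function is of positive type precisely when the matrix `(φ (g⁻¹ h))` indexed by `G` is
positive semidefinite; this direction gives access to the Schur product theorem and to reproducing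
kernel Hilbert spaces. -/
theorem IsPositiveType.posSemidef (h : IsPositiveType φ) :
    (Matrix.of fun g k : G => φ (g⁻¹ * k)).PosSemidef := by
  refine ⟨Matrix.IsHermitian.ext fun i j => ?_, fun x => ?_⟩
  · simp [← h.map_inv]
  · have := h.sum_nonneg (fun i : x.support => x i) (fun i => i)
    rw [Finset.sum_comm] at this
    simp only [Finsupp.sum]
    rw [← Finset.sum_coe_sort]
    convert this using 2 with i
    rw [← Finset.sum_coe_sort]
    exact Finset.sum_congr rfl fun j _ => by
      simp only [Matrix.of_apply, RCLike.star_def]; ring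

theorem isPositiveType_of_posSemidef
    (h : (Matrix.of fun g k : G => φ (g⁻¹ * k)).PosSemidef) : IsPositiveType φ := by
  intro n c g
  have := (h.submatrix g).dotProduct_mulVec_nonneg c
  rw [Finset.sum_comm]
  convert this using 1
  simp only [dotProduct, Matrix.mulVec, Finset.mul_sum]
  exact Finset.sum_congr rfl fun i _ => Finset.sum_congr rfl fun j _ => by
    simp only [Matrix.of_apply, Matrix.submatrix_apply, Pi.star_apply, RCLike.star_def]; ring

/-- The Schur product theorem for functions of positive type. -/
theorem IsPositiveType.mul (h : IsPositiveType φ) (h' : IsPositiveType ψ) :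
    IsPositiveType (fun g => φ g * ψ g) :=
  isPositiveType_of_posSemidef (h.posSemidef.hadamard h'.posSemidef)

end PositiveType

/-! ### Functions dominated by a character -/

section Extremality

variable {G : Type*} [Group G] {φ : G → ℂ}

/-- Normalizing the sum of a trace and a central function of positive type gives a trace; the
constant `Φ 1 + 1` is never zero. -/
theorem IsTrace.of_add {Φ : G → ℂ} (hφ : IsTrace φ) (hΦ : IsPositiveType Φ)
    (hc : ∀ g x, Φ (g * x * g⁻¹) = Φ x) :
    IsTrace (fun g => (Φ 1 + 1)⁻¹ * (Φ g + φ g)) where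
  positiveType := (hΦ.add hφ.positiveType).const_mul
    (inv_nonneg.2 (add_nonneg hΦ.one_nonneg zero_le_one))
  central g x := by simp only [hc, hφ.central]
  normalized := by
    rw [hφ.normalized]
    exact inv_mul_cancel₀ (add_pos_of_nonneg_of_pos hΦ.one_nonneg zero_lt_one).ne'

/-- A central function of positive type dominated by a multiple of a character is a multiple of
that character. -/
theorem eq_smul_of_mem_Char (hφ : φ ∈ Char G) {Φ Φ' : G → ℂ} {r : ℂ}
    (hΦ : IsPositiveType Φ) (hΦ' : IsPositiveType Φ')
    (hc : ∀ g x, Φ (g * x * g⁻¹) = Φ x) (hc' : ∀ g x, Φ' (g * x * g⁻¹) = Φ' x)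
    (hsum : ∀ g, Φ g + Φ' g = r * φ g) (g : G) : Φ g = Φ 1 * φ g := by
  have htr : IsTrace φ := hφ.1
  -- Adding `φ` to both functions keeps the normalizing constants away from zero.
  obtain ⟨a, ha0, ha⟩ : ∃ a : ℝ, 0 ≤ a ∧ (a : ℂ) = Φ 1 :=
    ⟨_, (Complex.nonneg_iff.1 hΦ.one_nonneg).1,
      Complex.ext rfl (Complex.nonneg_iff.1 hΦ.one_nonneg).2⟩
  obtain ⟨b, hb0, hb⟩ : ∃ b : ℝ, 0 ≤ b ∧ (b : ℂ) = Φ' 1 :=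
    ⟨_, (Complex.nonneg_iff.1 hΦ'.one_nonneg).1,
      Complex.ext rfl (Complex.nonneg_iff.1 hΦ'.one_nonneg).2⟩
  have hr : r = a + b := by
    have := hsum 1
    rw [htr.normalized, mul_one, ← ha, ← hb] at this
    exact this.symm
  have ha1 : (a + 1 : ℂ) ≠ 0 := by exact_mod_cast (by positivity : a + 1 ≠ 0)
  have hb1 : (b + 1 : ℂ) ≠ 0 := by exact_mod_cast (by positivity : b + 1 ≠ 0)
  have hab : (a + b + 2 : ℂ) ≠ 0 := by exact_mod_cast (by positivity : a + b + 2 ≠ 0)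
  have key := hφ.2 (htr.of_add hΦ hc) (htr.of_add hΦ' hc') ?_
  · have := congrFun key g
    simp only [← ha] at this ⊢
    field_simp at this
    linear_combination this
  · refine ⟨(a + 1) / (a + b + 2), (b + 1) / (a + b + 2), by positivity, by positivity, ?_, ?_⟩
    · field_simp
      ring
    · funext x
      simp only [Pi.add_apply, Pi.smul_apply, Complex.real_smul, ← ha, ← hb]
      push_cast
      field_simp
      have := hsum x
      rw [hr] at this
      linear_combination this

end Extremality

/-- Polarization: the values of `2 p + c u + conj c * w` for `c` of modulus one (the fourth roots
of unity suffice) determine `u`. -/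
theorem eq_of_forall_fourth_root {p p' u u' w w' : ℂ}
    (h : ∀ c : ℂ, c * conj c = 1 →
      2 * p + c * u + conj c * w = 2 * p' + c * u' + conj c * w') : u = u' := by
  have h1 := h 1 (by simp)
  have h2 := h (-1) (by simp)
  have h3 := h Complex.I (by simp)
  have h4 := h (-Complex.I) (by simp)
  simp only [map_neg, map_one, Complex.conj_I] at h1 h2 h3 h4
  linear_combination (1 / 4 : ℂ) * (h1 - h2) - Complex.I / 4 * (h3 - h4) +
    (u - u' - w + w') / 2 * Complex.I_sq

/-! ### Products of traces and of characters -/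

section Product

variable {G₁ G₂ : Type*} [Group G₁] [Group G₂]

theorem IsTrace.tensor {φ₁ : G₁ → ℂ} {φ₂ : G₂ → ℂ} (h₁ : IsTrace φ₁) (h₂ : IsTrace φ₂) :
    IsTrace (tensor φ₁ φ₂) where
  positiveType := (h₁.positiveType.comp_monoidHom (MonoidHom.fst G₁ G₂)).mul
    (h₂.positiveType.comp_monoidHom (MonoidHom.snd G₁ G₂))
  central g x := by simp [GroupTrace.tensor, h₁.central, h₂.central]
  normalized := by simp [GroupTrace.tensor, h₁.normalized, h₂.normalized]

theorem IsTrace.comp_inl {φ : G₁ × G₂ → ℂ} (h : IsTrace φ) : IsTrace (fun x => φ (x, 1)) where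
  positiveType := h.positiveType.comp_monoidHom (MonoidHom.inl G₁ G₂)
  central g x := by simpa using h.central (g, 1) (x, 1)
  normalized := h.normalized

theorem IsTrace.comp_inr {φ : G₁ × G₂ → ℂ} (h : IsTrace φ) : IsTrace (fun y => φ (1, y)) where
  positiveType := h.positiveType.comp_monoidHom (MonoidHom.inr G₁ G₂)
  central g x := by simpa using h.central (1, g) (1, x)
  normalized := h.normalized

/-- Pairing the second variable with the positive element `(1 + c y)* (1 + c y)` of the group
algebra of `G₂` leaves a function of positive type in the first variable. -/
theorem IsPositiveType.pair_snd {ψ : G₁ × G₂ → ℂ} (h : IsPositiveType ψ) (y : G₂) {c : ℂ}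
    (hc : c * conj c = 1) :
    IsPositiveType (fun x => 2 * ψ (x, 1) + c * ψ (x, y) + conj c * ψ (x, y⁻¹)) := by
  intro n d g
  have := h.sum_nonneg (fun p : Fin n × Fin 2 => d p.1 * ![1, c] p.2)
    (fun p => (g p.1, ![1, y] p.2))
  -- The term of `(1 + c y)* (1 + c y)` with `y⁻¹ y` has coefficient `c * conj c`.
  simp only [Fintype.sum_prod_type, Fin.sum_univ_two, ← Finset.sum_add_distrib] at this
  convert this using 4 with i _ j
  simp
  linear_combination (-d i * conj (d j) * ψ ((g j)⁻¹ * g i, 1)) * hc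

/-- The easy half: `φ₁ ⊗ φ₂` is extreme, because a trace `ψ` it dominates gives, on pairing the
second variable with positive elements, central functions dominated by multiples of `φ₁`. -/
theorem tensor_mem_Char {φ₁ : G₁ → ℂ} {φ₂ : G₂ → ℂ} (h₁ : φ₁ ∈ Char G₁) (h₂ : φ₂ ∈ Char G₂) :
    tensor φ₁ φ₂ ∈ Char (G₁ × G₂) := by
  have t₁ : IsTrace φ₁ := h₁.1
  have t₂ : IsTrace φ₂ := h₂.1
  refine ⟨t₁.tensor t₂, fun ψ hψ ψ' hψ' hseg => ?_⟩
  replace hψ : IsTrace ψ := hψ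
  replace hψ' : IsTrace ψ' := hψ'
  obtain ⟨s, t, hs, ht, hst, hcomb⟩ := hseg
  have hval : ∀ x y, (s : ℂ) * ψ (x, y) + t * ψ' (x, y) = φ₁ x * φ₂ y := fun x y => by
    simpa [tensor] using congrFun hcomb (x, y)
  have hs0 : (0 : ℂ) ≤ s := by exact_mod_cast hs.le
  have ht0 : (0 : ℂ) ≤ t := by exact_mod_cast ht.le
  have hsne : (s : ℂ) ≠ 0 := by exact_mod_cast hs.ne'
  have hcent : ∀ {χ : G₁ × G₂ → ℂ}, IsTrace χ → ∀ (g x : G₁) (y : G₂),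
      χ (g * x * g⁻¹, y) = χ (x, y) := fun hχ g x y => by
    simpa using hχ.central (g, 1) (x, y)
  have hprod : ∀ x y, ψ (x, y) = ψ (1, y) * φ₁ x := fun x y => by
    refine eq_of_forall_fourth_root (p := ψ (x, 1)) (w := ψ (x, y⁻¹))
      (p' := ψ (1, 1) * φ₁ x) (w' := ψ (1, y⁻¹) * φ₁ x) fun c hc => ?_
    have := eq_smul_of_mem_Char h₁ (r := 2 * φ₂ 1 + c * φ₂ y + conj c * φ₂ y⁻¹)
      ((hψ.positiveType.pair_snd y hc).const_mul hs0)
      ((hψ'.positiveType.pair_snd y hc).const_mul ht0)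
      (fun g x => by simp only [hcent hψ]) (fun g x => by simp only [hcent hψ'])
      (fun g => by
        linear_combination 2 * hval g 1 + c * hval g y + conj c * hval g y⁻¹) x
    exact mul_left_cancel₀ hsne (by linear_combination this)
  have hsnd : (fun y => ψ (1, y)) = φ₂ := by
    refine h₂.2 hψ.comp_inr hψ'.comp_inr ⟨s, t, hs, ht, hst, funext fun y => ?_⟩
    simpa [t₁.normalized] using hval 1 y
  funext ⟨x, y⟩
  rw [hprod, congrFun hsnd y, tensor, mul_comm]

/-- The factors of a character of product form are characters, since `ψ ↦ ψ ⊗ φ₂` is affine and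
injective. -/
theorem left_mem_Char_of_tensor {φ₁ : G₁ → ℂ} {φ₂ : G₂ → ℂ} (t₁ : IsTrace φ₁) (t₂ : IsTrace φ₂)
    (h : tensor φ₁ φ₂ ∈ Char (G₁ × G₂)) : φ₁ ∈ Char G₁ := by
  refine ⟨t₁, fun ψ hψ ψ' hψ' ⟨s, t, hs, ht, hst, hcomb⟩ => ?_⟩
  have := h.2 (IsTrace.tensor hψ t₂) (IsTrace.tensor hψ' t₂)
    ⟨s, t, hs, ht, hst, funext fun x => ?_⟩
  · funext x
    simpa [tensor, t₂.normalized] using congrFun this (x, 1)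
  · simp [tensor, ← hcomb]
    ring

theorem right_mem_Char_of_tensor {φ₁ : G₁ → ℂ} {φ₂ : G₂ → ℂ} (t₁ : IsTrace φ₁) (t₂ : IsTrace φ₂)
    (h : tensor φ₁ φ₂ ∈ Char (G₁ × G₂)) : φ₂ ∈ Char G₂ := by
  refine ⟨t₂, fun ψ hψ ψ' hψ' ⟨s, t, hs, ht, hst, hcomb⟩ => ?_⟩
  have := h.2 (IsTrace.tensor t₁ hψ) (IsTrace.tensor t₁ hψ')
    ⟨s, t, hs, ht, hst, funext fun x => ?_⟩
  · funext y
    simpa [tensor, t₁.normalized] using congrFun this (1, y)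
  · simp [tensor, ← hcomb]
    ring

end Product

/-! ### The GNS space of a function of positive type -/

/-- A family of vectors `v g` in a Hilbert space realizes `φ` if it has the Gram matrix
`⟪v g, v h⟫ = φ (g⁻¹ h)` and spans a dense subspace: this is the GNS space of `φ`, with
`v g` the translate by `g` of the cyclic vector `v 1`. -/
structure IsGNS {G H : Type*} [Group G] [NormedAddCommGroup H] [InnerProductSpace ℂ H]
    (φ : G → ℂ) (v : G → H) : Prop where
  inner_eq : ∀ g h, ⟪v g, v h⟫_ℂ = φ (g⁻¹ * h)
  dense : (span ℂ (Set.range v)).topologicalClosure = ⊤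

/-- The GNS construction, as the reproducing kernel Hilbert space of the kernel `φ (g⁻¹ h)`. -/
theorem IsPositiveType.exists_isGNS.{u} {G : Type u} [Group G] {φ : G → ℂ} (h : IsPositiveType φ) :
    ∃ (H : Type u) (_ : NormedAddCommGroup H) (_ : InnerProductSpace ℂ H) (_ : CompleteSpace H)
      (v : G → H), IsGNS φ v := by
  let K : Matrix G G (ℂ →L[ℂ] ℂ) := Matrix.of fun g k => φ (g⁻¹ * k) • ContinuousLinearMap.id ℂ ℂ
  have hK : K.PosSemidef := by
    have key := (RKHS.posSemidef_tfae (K := K)).out 0 2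
    refine key.2 ⟨Matrix.IsHermitian.ext fun i j => ?_, fun x => ?_⟩
    · simp only [K, Matrix.of_apply, star_smul]
      rw [RCLike.star_def, ← h.map_inv]
      rw [ContinuousLinearMap.star_eq_adjoint, ContinuousLinearMap.adjoint_id]
      simp
    · have := (h.posSemidef.2 x)
      refine le_of_le_of_eq (Complex.nonneg_iff.1 this).1 ?_
      refine congrArg Complex.re ?_
      refine Finsupp.sum_congr fun i _ => Finsupp.sum_congr fun j _ => ?_
      simp [K, ← h.map_inv]
      ring
  have : Fact K.PosSemidef := ⟨hK⟩
  refine ⟨RKHS.OfKernel K, inferInstance, inferInstance, inferInstance,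
    fun g => RKHS.kerFun (RKHS.OfKernel K) g 1, fun g k => ?_, ?_⟩
  · rw [← RKHS.kernel_inner, RKHS.OfKernel.kernel_ofKernel]
    simp [K]
    rw [← h.map_inv]
    simp
  · rw [← RKHS.kerFun_dense]
    congr 1
    refine le_antisymm (span_mono ?_) (span_le.2 ?_)
    · rintro _ ⟨g, rfl⟩
      exact ⟨g, 1, rfl⟩
    · rintro _ ⟨g, z, rfl⟩
      rw [← mul_one z, ← smul_eq_mul, map_smul]
      exact Submodule.smul_mem _ _ (subset_span ⟨g, rfl⟩)

section Lift

variable {G H : Type*} [Group G] [NormedAddCommGroup H] [InnerProductSpace ℂ H]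
  {φ : G → ℂ} {v : G → H}

theorem IsGNS.denseRange (hv : IsGNS φ v) : DenseRange (Finsupp.linearCombination ℂ v) := by
  have := hv.dense
  rw [← Finsupp.range_linearCombination, ← Submodule.dense_iff_topologicalClosure_eq_top] at this
  exact this

/-- Two semilinear continuous maps agreeing on the vectors `v g` are equal. -/
theorem IsGNS.ext (hv : IsGNS φ v) {τ : ℂ →+* ℂ} {S T : H →SL[τ] H}
    (h : ∀ g, S (v g) = T (v g)) : S = T := by
  refine ContinuousLinearMap.ext_on (s := Set.range v) ?_ ?_
  · exact Submodule.dense_iff_topologicalClosure_eq_top.2 hv.dense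
  · rintro _ ⟨g, rfl⟩
    exact h g

/-- A family whose Gram matrix is that of `v`, or its complex conjugate, is the image of `v` under
an isometry that is linear, respectively conjugate linear. -/
theorem IsGNS.exists_lift [CompleteSpace H] (hv : IsGNS φ v) {τ : ℂ →+* ℂ} [RingHomIsometric τ]
    (hτ : ∀ z, τ (conj z) = conj (τ z)) (w : G → H)
    (h : ∀ g k, ⟪w g, w k⟫_ℂ = τ ⟪v g, v k⟫_ℂ) :
    ∃ U : H →SL[τ] H, (∀ g, U (v g) = w g) ∧ ∀ x y, ⟪U x, U y⟫_ℂ = τ ⟪x, y⟫_ℂ := by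
  let M : (G →₀ ℂ) →ₛₗ[τ] H :=
    { toFun := fun c => c.sum fun g a => τ a • w g
      map_add' := fun a b => by
        rw [Finsupp.sum_add_index'] <;> simp [add_smul]
      map_smul' := fun r a => by
        rw [Finsupp.sum_smul_index] <;> simp [Finsupp.smul_sum, mul_smul] }
  have hM : ∀ c d, ⟪M c, M d⟫_ℂ =
      τ ⟪Finsupp.linearCombination ℂ v c, Finsupp.linearCombination ℂ v d⟫_ℂ := fun c d => by
    simp only [M, LinearMap.coe_mk, AddHom.coe_mk, Finsupp.linearCombination_apply,
      Finsupp.sum, inner_sum, sum_inner, inner_smul_left, inner_smul_right, map_sum, map_mul, h, hτ]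
  have hnorm : ∀ c, ‖M c‖ ≤ 1 * ‖Finsupp.linearCombination ℂ v c‖ := fun c => by
    have := congrArg norm (hM c c)
    rw [RingHomIsometric.norm_map, inner_self_eq_norm_sq_to_K, inner_self_eq_norm_sq_to_K] at this
    simp only [norm_pow, RCLike.norm_ofReal, abs_norm] at this
    rw [one_mul]
    exact ((sq_eq_sq₀ (norm_nonneg _) (norm_nonneg _)).1 this).le
  have hU := LinearMap.extendOfNorm_eq hv.denseRange ⟨1, hnorm⟩
  have hτc : Continuous τ :=
    (AddMonoidHomClass.isometry_of_norm τ fun _ => RingHomIsometric.norm_map).continuous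
  refine ⟨M.extendOfNorm (Finsupp.linearCombination ℂ v), fun g => ?_, fun x y => ?_⟩
  · simpa [M] using hU (Finsupp.single g 1)
  · refine hv.denseRange.induction_on₂ (p := fun x y =>
      ⟪M.extendOfNorm (Finsupp.linearCombination ℂ v) x,
        M.extendOfNorm (Finsupp.linearCombination ℂ v) y⟫_ℂ = τ ⟪x, y⟫_ℂ) ?_ ?_ x y
    · exact isClosed_eq (by fun_prop) (hτc.comp (by fun_prop))
    · intro c d
      rw [hU, hU, hM]

end Lift

/-- A semilinear isometry permuting the generators of a closed subspace commutes with the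
orthogonal projection onto it. -/
theorem starProjection_comm {H X : Type*} [NormedAddCommGroup H] [InnerProductSpace ℂ H]
    [CompleteSpace H] {τ : ℂ →+* ℂ} [RingHomIsometric τ] {U : H →SL[τ] H}
    (hU : ∀ x y, ⟪U x, U y⟫_ℂ = τ ⟪x, y⟫_ℂ) (u : X → H) (e : X ≃ X) (he : ∀ x, U (u x) = u (e x))
    (w : H) :
    (span ℂ (Set.range u)).topologicalClosure.starProjection (U w) =
      U ((span ℂ (Set.range u)).topologicalClosure.starProjection w) := by
  set K := (span ℂ (Set.range u)).topologicalClosure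
  have hmem : ∀ x, u x ∈ K := fun x =>
    Submodule.le_topologicalClosure _ (subset_span ⟨x, rfl⟩)
  apply Submodule.eq_starProjection_of_mem_of_inner_eq_zero
  · have hle : K ≤ K.comap U.toLinearMap := by
      refine Submodule.topologicalClosure_minimal _ (span_le.2 ?_) ?_
      · rintro _ ⟨x, rfl⟩
        simpa [he] using hmem (e x)
      · exact (Submodule.isClosed_topologicalClosure _).preimage U.continuous
    exact hle (K.starProjection_apply_mem w)
  · intro z hz
    have hle : K ≤ LinearMap.ker (innerSL ℂ (U w - U (K.starProjection w))).toLinearMap := by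
      refine Submodule.topologicalClosure_minimal _ (span_le.2 ?_) ?_
      · rintro _ ⟨x, rfl⟩
        have h0 : ⟪w - K.starProjection w, u (e.symm x)⟫_ℂ = 0 :=
          K.starProjection_inner_eq_zero w _ (hmem _)
        have := hU (w - K.starProjection w) (u (e.symm x))
        rw [h0, map_zero, he, e.apply_symm_apply, map_sub] at this
        simpa using this
      · exact ContinuousLinearMap.isClosed_ker _
    exact hle hz

/-! ### The unitary representation on the GNS space -/

section Translate

variable {G H : Type*} [Group G] [NormedAddCommGroup H] [InnerProductSpace ℂ H] [CompleteSpace H]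
  {φ : G → ℂ} {v : G → H}

theorem IsGNS.exists_translate (hv : IsGNS φ v) (k : G) :
    ∃ U : H →L[ℂ] H, (∀ g, U (v g) = v (k * g)) ∧ ∀ x y, ⟪U x, U y⟫_ℂ = ⟪x, y⟫_ℂ :=
  hv.exists_lift (τ := RingHom.id ℂ) (fun _ => rfl) (fun g => v (k * g)) fun g l => by
    simp [hv.inner_eq, mul_assoc]

/-- The unitary representation of `G` on the GNS space by left translation. -/
noncomputable def IsGNS.translate (hv : IsGNS φ v) (k : G) : H →L[ℂ] H :=
  (hv.exists_translate k).choose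

theorem IsGNS.translate_apply (hv : IsGNS φ v) (k g : G) : hv.translate k (v g) = v (k * g) :=
  (hv.exists_translate k).choose_spec.1 g

theorem IsGNS.inner_translate_translate (hv : IsGNS φ v) (k : G) (x y : H) :
    ⟪hv.translate k x, hv.translate k y⟫_ℂ = ⟪x, y⟫_ℂ :=
  (hv.exists_translate k).choose_spec.2 x y

theorem IsGNS.translate_one (hv : IsGNS φ v) : hv.translate 1 = 1 :=
  hv.ext fun g => by simp [hv.translate_apply]

theorem IsGNS.translate_mul (hv : IsGNS φ v) (k l : G) :
    hv.translate (k * l) = hv.translate k * hv.translate l :=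
  hv.ext fun g => by simp [hv.translate_apply, mul_assoc]

theorem IsGNS.translate_mul_apply (hv : IsGNS φ v) (k l : G) (w : H) :
    hv.translate (k * l) w = hv.translate k (hv.translate l w) := by
  rw [hv.translate_mul, mul_apply_eq_comp]

theorem IsGNS.inner_translate_right (hv : IsGNS φ v) (k : G) (x y : H) :
    ⟪x, hv.translate k y⟫_ℂ = ⟪hv.translate k⁻¹ x, y⟫_ℂ := by
  rw [← hv.inner_translate_translate k⁻¹ x, ← hv.translate_mul_apply,
    inv_mul_cancel, hv.translate_one, one_apply_eq_self]

theorem IsGNS.star_translate (hv : IsGNS φ v) (k : G) :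
    star (hv.translate k) = hv.translate k⁻¹ := by
  rw [ContinuousLinearMap.star_eq_adjoint, eq_comm, ContinuousLinearMap.eq_adjoint_iff]
  intro x y
  rw [hv.inner_translate_right]

end Translate

/-! ### The GNS space of the first factor -/

section FirstSpace

variable {G₁ G₂ H : Type*} [Group G₂] [NormedAddCommGroup H] [InnerProductSpace ℂ H]
  {v : G₁ × G₂ → H}

/-- The closed span of the orbit of the cyclic vector under the first factor: the GNS space of
the restriction of `φ` to `G₁`. -/
def firstSpace (v : G₁ × G₂ → H) : Submodule ℂ H :=
  (span ℂ (Set.range fun x : G₁ => v (x, 1))).topologicalClosure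

theorem mem_firstSpace (x : G₁) : v (x, 1) ∈ firstSpace v :=
  Submodule.le_topologicalClosure _ (subset_span ⟨x, rfl⟩)

theorem firstSpace_le_of_closed {K : Submodule ℂ H} (hK : IsClosed (K : Set H))
    (h : ∀ x, v (x, 1) ∈ K) : firstSpace v ≤ K :=
  Submodule.topologicalClosure_minimal _ (span_le.2 (by rintro _ ⟨x, rfl⟩; exact h x)) hK

theorem eq_zero_of_forall_inner_eq_zero {w : H} (hw : w ∈ firstSpace v)
    (h : ∀ x, ⟪v (x, 1), w⟫_ℂ = 0) : w = 0 := by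
  have hle : firstSpace v ≤ (ℂ ∙ w)ᗮ :=
    firstSpace_le_of_closed (Submodule.isClosed_orthogonal _) fun x =>
      Submodule.mem_orthogonal_singleton_iff_inner_left.2 (h x)
  exact inner_self_eq_zero.1 (Submodule.mem_orthogonal_singleton_iff_inner_left.1 (hle hw))

variable [CompleteSpace H]

instance : CompleteSpace (firstSpace v) :=
  inferInstanceAs (CompleteSpace (span ℂ (Set.range fun x : G₁ => v (x, 1))).topologicalClosure)

/-- The orthogonal projection onto the GNS space of the first factor. -/
noncomputable def firstProj (v : G₁ × G₂ → H) : H →L[ℂ] H := (firstSpace v).starProjection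

theorem firstProj_mem (w : H) : firstProj v w ∈ firstSpace v :=
  (firstSpace v).starProjection_apply_mem w

theorem firstProj_eq_self {w : H} (hw : w ∈ firstSpace v) : firstProj v w = w :=
  Submodule.starProjection_eq_self_iff.2 hw

theorem firstProj_apply (x : G₁) : firstProj v (v (x, 1)) = v (x, 1) :=
  firstProj_eq_self (mem_firstSpace x)

theorem firstProj_mul_self : firstProj v * firstProj v = firstProj v :=
  ContinuousLinearMap.ext fun w => firstProj_eq_self (firstProj_mem w)

theorem inner_firstProj (x y : H) : ⟪firstProj v x, y⟫_ℂ = ⟪x, firstProj v y⟫_ℂ :=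
  (firstSpace v).inner_starProjection_left_eq_right x y

theorem star_firstProj : star (firstProj v) = firstProj v := by
  rw [ContinuousLinearMap.star_eq_adjoint, eq_comm, ContinuousLinearMap.eq_adjoint_iff]
  exact inner_firstProj

end FirstSpace

/-! ### Compressions of the second factor -/

section Factor

variable {G₁ G₂ H : Type*} [Group G₁] [Group G₂] [NormedAddCommGroup H] [InnerProductSpace ℂ H]
  [CompleteSpace H] {φ : G₁ × G₂ → ℂ} {v : G₁ × G₂ → H}

/-- The projection onto the first GNS space is equivariant under every permutation of the group
that preserves the first factor and preserves, or conjugates, the Gram matrix. -/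
theorem IsGNS.inner_firstProj_perm (hv : IsGNS φ v) {τ : ℂ →+* ℂ} [RingHomIsometric τ]
    (hτ : ∀ z, τ (conj z) = conj (τ z)) (σ : G₁ × G₂ → G₁ × G₂) (e : G₁ ≃ G₁)
    (he : ∀ x, σ (x, 1) = (e x, 1))
    (h : ∀ g k, φ ((σ g)⁻¹ * σ k) = τ (φ (g⁻¹ * k))) (g k : G₁ × G₂) :
    ⟪v (σ g), firstProj v (v (σ k))⟫_ℂ = τ ⟪v g, firstProj v (v k)⟫_ℂ := by
  obtain ⟨U, hU, hin⟩ := hv.exists_lift hτ (fun g => v (σ g)) fun g k => by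
    simp only [hv.inner_eq, h]
  rw [← hin, ← hU, ← hU, firstProj]
  congr 1
  exact starProjection_comm hin (fun x : G₁ => v (x, 1)) e (fun x => by rw [hU, he]) _

theorem IsGNS.firstProj_translate (hv : IsGNS φ v) (x : G₁) :
    Commute (firstProj v) (hv.translate (x, 1)) :=
  ContinuousLinearMap.ext fun w =>
    starProjection_comm (τ := RingHom.id ℂ) (hv.inner_translate_translate (x, 1))
      (fun x : G₁ => v (x, 1)) (Equiv.mulLeft x) (fun y => by simp [hv.translate_apply]) w

/-- The compression of the translation by an element of the second factor to the GNS space of the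
first factor (extended by zero to the whole space). -/
noncomputable def IsGNS.compress (hv : IsGNS φ v) (y : G₂) : H →L[ℂ] H :=
  firstProj v * hv.translate (1, y) * firstProj v

theorem IsGNS.compress_apply (hv : IsGNS φ v) (x : G₁) (y : G₂) :
    hv.compress y (v (x, 1)) = firstProj v (v (x, y)) := by
  simp [compress, firstProj_apply, hv.translate_apply]

theorem IsGNS.star_compress (hv : IsGNS φ v) (y : G₂) :
    star (hv.compress y) = hv.compress y⁻¹ := by
  simp [compress, star_firstProj, hv.star_translate, mul_assoc]

theorem IsGNS.firstProj_mul_compress (hv : IsGNS φ v) (y : G₂) :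
    firstProj v * hv.compress y = hv.compress y := by
  rw [compress, ← mul_assoc, ← mul_assoc, firstProj_mul_self]

theorem IsGNS.compress_mul_firstProj (hv : IsGNS φ v) (y : G₂) :
    hv.compress y * firstProj v = hv.compress y := by
  rw [compress, mul_assoc, firstProj_mul_self]

theorem IsGNS.compress_translate (hv : IsGNS φ v) (x : G₁) (y : G₂) :
    Commute (hv.compress y) (hv.translate (x, 1)) := by
  have : Commute (hv.translate (1, y)) (hv.translate (x, 1)) := by
    rw [Commute, SemiconjBy, ← hv.translate_mul, ← hv.translate_mul]
    simp
  exact ((hv.firstProj_translate x).mul_left this).mul_left (hv.firstProj_translate x)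

/-- Conjugating the second argument by any element of the product does not change the projection
of `v (1, y)`: this vector is central. -/
theorem IsGNS.firstProj_conj (hv : IsGNS φ v) (ht : IsTrace φ) (k y : G₂) :
    firstProj v (v (1, k * y * k⁻¹)) = firstProj v (v (1, y)) := by
  rw [← sub_eq_zero, ← map_sub]
  refine eq_zero_of_forall_inner_eq_zero (firstProj_mem _) fun x => ?_
  rw [← inner_firstProj, firstProj_apply, inner_sub_right, hv.inner_eq, hv.inner_eq, sub_eq_zero]
  simpa using ht.central (1, k) (x⁻¹, y)

theorem IsGNS.inner_firstProj_conj (hv : IsGNS φ v) (ht : IsTrace φ) (k g h : G₁ × G₂) :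
    ⟪v (k * g * k⁻¹), firstProj v (v (k * h * k⁻¹))⟫_ℂ = ⟪v g, firstProj v (v h)⟫_ℂ :=
  hv.inner_firstProj_perm (τ := RingHom.id ℂ) (fun _ => rfl) (fun g => k * g * k⁻¹)
    (MulAut.conj k.1).toEquiv (fun x => by simp [Prod.ext_iff])
    (fun g h => by
      rw [RingHom.id_apply, ← ht.central k (g⁻¹ * h)]
      congr 1
      group) g h

/-- Inversion reverses the inner products of projected vectors. It acts on the GNS space by the
modular conjugation `v g ↦ v g⁻¹`, which is antiunitary since `φ` is central. -/
theorem IsGNS.inner_firstProj_inv (hv : IsGNS φ v) (ht : IsTrace φ) (g h : G₁ × G₂) :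
    ⟪v g⁻¹, firstProj v (v h⁻¹)⟫_ℂ = ⟪v h, firstProj v (v g)⟫_ℂ := by
  rw [hv.inner_firstProj_perm (τ := starRingEnd ℂ) (fun _ => rfl) (fun g => g⁻¹) (Equiv.inv G₁)
    (fun x => by simp) (fun g h => ?_), inner_conj_symm, inner_firstProj]
  rw [← ht.positiveType.map_inv, ← ht.central h⁻¹]
  congr 1
  group

/-- The compressions commute. They lie in the centre of the von Neumann algebra generated by the
first factor on its GNS space; the proof moves one of them to the other side of the inner product
with the modular conjugation. -/
theorem IsGNS.compress_comm (hv : IsGNS φ v) (ht : IsTrace φ) (y y' : G₂) :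
    Commute (hv.compress y) (hv.compress y') := by
  have hinner : ∀ (x x' : G₁) (y y' : G₂),
      ⟪v (x', 1), (hv.compress y * hv.compress y') (v (x, 1))⟫_ℂ =
        ⟪v (x', y⁻¹), firstProj v (v (x, y'))⟫_ℂ := fun x x' y y' => by
    rw [mul_apply_eq_comp, ← ContinuousLinearMap.adjoint_inner_left,
      ← ContinuousLinearMap.star_eq_adjoint, hv.star_compress, hv.compress_apply,
      hv.compress_apply, inner_firstProj, ← mul_apply_eq_comp, firstProj_mul_self]
  have hleft : ∀ (k : G₁) (g h : G₁ × G₂),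
      ⟪v ((k, 1) * g), firstProj v (v ((k, 1) * h))⟫_ℂ = ⟪v g, firstProj v (v h)⟫_ℂ :=
    fun k g h => hv.inner_firstProj_perm (τ := RingHom.id ℂ) (fun _ => rfl) (fun g => (k, 1) * g)
      (Equiv.mulLeft k) (fun x => by simp)
      (fun g h => by rw [RingHom.id_apply]; congr 1; group) g h
  have hsymm : ∀ (x x' : G₁) (y y' : G₂),
      ⟪v (x', y⁻¹), firstProj v (v (x, y'))⟫_ℂ = ⟪v (x', y'⁻¹), firstProj v (v (x, y))⟫_ℂ := by
    intro x x' y y'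
    -- Invert, then translate and conjugate back by elements of the first factor.
    have h1 := hv.inner_firstProj_inv ht (x'⁻¹, y) (x⁻¹, y'⁻¹)
    have h2 := hleft x (x⁻¹, y'⁻¹) (x'⁻¹, y)
    have h3 := hv.inner_firstProj_conj ht (x'⁻¹, 1) (1, y'⁻¹) (x * x'⁻¹, y)
    have h4 := hleft x' (x'⁻¹ * x'⁻¹⁻¹, y'⁻¹) (x'⁻¹ * (x * x'⁻¹) * x'⁻¹⁻¹, y)
    simp only [mul_assoc, Prod.inv_mk, Prod.mk_mul_mk, inv_inv, mul_inv_cancel, inv_mul_cancel,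
      one_mul, mul_one, mul_inv_cancel_left, inv_one] at h1 h2 h3 h4
    rw [h1, ← h2, ← h3, ← h4]
  -- The commutator vanishes on the first GNS space by symmetry, and trivially on its complement.
  have hD : ∀ x : G₁, (hv.compress y * hv.compress y' - hv.compress y' * hv.compress y)
      (v (x, 1)) = 0 := fun x => by
    refine eq_zero_of_forall_inner_eq_zero (v := v) ?_ fun x' => ?_
    · rw [← hv.firstProj_mul_compress y, ← hv.firstProj_mul_compress y', mul_assoc, mul_assoc,
        ← mul_sub, mul_apply_eq_comp]
      exact firstProj_mem _
    · rw [_root_.sub_apply, inner_sub_right, hinner, hinner, hsymm, sub_self]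
  have hle := firstSpace_le_of_closed (v := v) (ContinuousLinearMap.isClosed_ker
    (hv.compress y * hv.compress y' - hv.compress y' * hv.compress y)) hD
  refine sub_eq_zero.1 (ContinuousLinearMap.ext fun w => ?_)
  have hP : (hv.compress y * hv.compress y' - hv.compress y' * hv.compress y) * firstProj v =
      hv.compress y * hv.compress y' - hv.compress y' * hv.compress y := by
    rw [sub_mul, mul_assoc, mul_assoc, hv.compress_mul_firstProj, hv.compress_mul_firstProj]
  rw [← hP, mul_apply_eq_comp]
  exact hle (firstProj_mem w)

/-- A positive operator `A` in the centre of the first factor defines a function of positive type: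
with `S = √A`, the quadratic form is `‖∑ cᵢ (1, yᵢ) S v (xᵢ, 1)‖²`. -/
theorem IsGNS.isPositiveType_of_nonneg (hv : IsGNS φ v) {A : H →L[ℂ] H} (hA : 0 ≤ A)
    (hP : Commute A (firstProj v)) (hT : ∀ x : G₁, Commute A (hv.translate (x, 1)))
    (hE : ∀ y, Commute A (hv.compress y)) :
    IsPositiveType (fun z => ⟪v 1, hv.translate z (A (v 1))⟫_ℂ) := by
  obtain ⟨S, hSA, hS0, hSc⟩ : ∃ S : H →L[ℂ] H, S * S = A ∧ 0 ≤ S ∧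
      ∀ B : H →L[ℂ] H, Commute A B → Commute S B :=
    ⟨CFC.sqrt A, CFC.sqrt_mul_sqrt_self A, CFC.sqrt_nonneg A, fun B hB => by
      rw [CFC.sqrt_eq_cfc]
      exact hB.cfc_nnreal _⟩
  have hSs : star S = S := (IsSelfAdjoint.of_nonneg hS0).star_eq
  have hSin : ∀ x y, ⟪S x, y⟫_ℂ = ⟪x, S y⟫_ℂ := fun x y => by
    rw [← ContinuousLinearMap.adjoint_inner_right, ← ContinuousLinearMap.star_eq_adjoint, hSs]
  have comm : ∀ {B C : H →L[ℂ] H}, Commute B C → ∀ w, B (C w) = C (B w) := fun h w =>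
    DFunLike.congr_fun h w
  have hSP : ∀ x : G₁, firstProj v (S (v (x, 1))) = S (v (x, 1)) := fun x => by
    rw [← comm (hSc _ hP), firstProj_apply]
  have hAP : ∀ x : G₁, firstProj v (A (v (x, 1))) = A (v (x, 1)) := fun x => by
    rw [← comm hP, firstProj_apply]
  have hgram : ∀ g k : G₁ × G₂, ⟪v 1, hv.translate (k⁻¹ * g) (A (v 1))⟫_ℂ =
      ⟪hv.translate (1, k.2) (S (v (k.1, 1))), hv.translate (1, g.2) (S (v (g.1, 1)))⟫_ℂ := by
    rintro ⟨x, y⟩ ⟨x', y'⟩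
    have hfac : ((x', y')⁻¹ * (x, y) : G₁ × G₂) =
        (x'⁻¹, 1) * ((1, y'⁻¹ * y) * (x, 1)) := by simp
    have hAx : hv.translate (x, 1) (A (v 1)) = A (v (x, 1)) := by
      rw [← comm (hT x), hv.translate_apply, mul_one]
    calc ⟪v 1, hv.translate ((x', y')⁻¹ * (x, y)) (A (v 1))⟫_ℂ
        = ⟪v (x', 1), hv.translate (1, y'⁻¹ * y) (A (v (x, 1)))⟫_ℂ := by
          rw [hfac, hv.translate_mul_apply, hv.translate_mul_apply, hAx,
            hv.inner_translate_right, hv.translate_apply]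
          simp
      _ = ⟪v (x', 1), hv.compress (y'⁻¹ * y) (S (S (v (x, 1))))⟫_ℂ := by
          rw [← mul_apply_eq_comp S S, hSA, IsGNS.compress, mul_apply_eq_comp, mul_apply_eq_comp,
            hAP, ← inner_firstProj, firstProj_apply]
      _ = ⟪S (v (x', 1)), hv.compress (y'⁻¹ * y) (S (v (x, 1)))⟫_ℂ := by
          rw [← comm (hSc _ (hE _)), hSin]
      _ = ⟪S (v (x', 1)), hv.translate (1, y'⁻¹ * y) (S (v (x, 1)))⟫_ℂ := by
          rw [IsGNS.compress, mul_apply_eq_comp, mul_apply_eq_comp, hSP, ← inner_firstProj, hSP]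
      _ = _ := by
          rw [← hv.inner_translate_translate (1, y'), ← hv.translate_mul_apply]
          simp
  intro n c g
  have hsum : ∑ i, ∑ j, c i * conj (c j) *
      ⟪v 1, hv.translate ((g j)⁻¹ * g i) (A (v 1))⟫_ℂ =
        ⟪∑ j, c j • hv.translate (1, (g j).2) (S (v ((g j).1, 1))),
          ∑ i, c i • hv.translate (1, (g i).2) (S (v ((g i).1, 1)))⟫_ℂ := by
    simp only [hgram, sum_inner, inner_sum, inner_smul_left, inner_smul_right]
    refine Finset.sum_congr rfl fun i _ => ?_
    rw [Finset.mul_sum]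
    exact Finset.sum_congr rfl fun j _ => by ring
  rw [hsum, inner_self_eq_norm_sq_to_K]
  rw [← RCLike.ofReal_pow]
  exact RCLike.ofReal_nonneg.2 (sq_nonneg _)

/-- The compression of the positive element `(1 + c y)* (1 + c y)`, for a scalar `c` of modulus
one, to the GNS space of the first factor. -/
noncomputable def IsGNS.posCompress (hv : IsGNS φ v) (y : G₂) (c : ℂ) : H →L[ℂ] H :=
  (2 : ℂ) • firstProj v + c • hv.compress y + conj c • hv.compress y⁻¹

theorem IsGNS.posCompress_nonneg (hv : IsGNS φ v) (y : G₂) {c : ℂ} (hc : c * conj c = 1) :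
    0 ≤ hv.posCompress y c := by
  have : hv.posCompress y c =
      star ((1 + c • hv.translate (1, y)) * firstProj v) *
        ((1 + c • hv.translate (1, y)) * firstProj v) := by
    have h1 : hv.translate (1, y⁻¹) * hv.translate (1, y) = 1 := by
      rw [← hv.translate_mul, ← hv.translate_one]
      simp [Prod.one_eq_mk]
    have h2 : ((1, y)⁻¹ : G₁ × G₂) = (1, y⁻¹) := by simp
    have h3 : (1 + conj c • hv.translate (1, y⁻¹)) * (1 + c • hv.translate (1, y)) =
        (2 : ℂ) • 1 + c • hv.translate (1, y) + conj c • hv.translate (1, y⁻¹) := by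
      rw [mul_add, add_mul, add_mul, smul_mul_smul_comm, h1, mul_comm, hc]
      simp only [one_mul, mul_one, two_smul, one_smul]
      abel
    rw [star_mul, star_firstProj, star_add, star_smul, hv.star_translate, star_one, h2,
      RCLike.star_def, mul_assoc, ← mul_assoc (1 + conj c • _), h3, IsGNS.posCompress,
      IsGNS.compress, IsGNS.compress]
    simp only [mul_add, add_mul, smul_mul_assoc, mul_smul_comm, one_mul, firstProj_mul_self,
      mul_assoc]
  rw [this]
  exact star_mul_self_nonneg _

/-- The component of `φ` cut out by `posCompress`. It is central and of positive type, and the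
components for `c` and `-c` add up to `4 φ`. -/
noncomputable def IsGNS.component (hv : IsGNS φ v) (y : G₂) (c : ℂ) (z : G₁ × G₂) : ℂ :=
  ⟪v 1, hv.translate z (hv.posCompress y c (v 1))⟫_ℂ

theorem IsGNS.component_eq (hv : IsGNS φ v) (y : G₂) (c : ℂ) (z : G₁ × G₂) :
    hv.component y c z = 2 * φ z + c * ⟪v z⁻¹, firstProj v (v (1, y))⟫_ℂ +
      conj c * ⟪v z⁻¹, firstProj v (v (1, y⁻¹))⟫_ℂ := by
  have h1 : (1 : G₁ × G₂) = (1, 1) := rfl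
  rw [IsGNS.component, hv.inner_translate_right, hv.translate_apply, mul_one, IsGNS.posCompress]
  simp only [_root_.add_apply, _root_.smul_apply, inner_add_right, inner_smul_right]
  rw [h1, hv.compress_apply, hv.compress_apply, firstProj_apply, hv.inner_eq, ← h1]
  simp

theorem IsGNS.isPositiveType_component (hv : IsGNS φ v) (ht : IsTrace φ) (y : G₂) {c : ℂ}
    (hc : c * conj c = 1) : IsPositiveType (hv.component y c) := by
  refine hv.isPositiveType_of_nonneg (hv.posCompress_nonneg y hc) ?_ (fun x => ?_) fun y' => ?_
  · have h : ∀ y, Commute (hv.compress y) (firstProj v) := fun y =>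
      (hv.compress_mul_firstProj y).trans (hv.firstProj_mul_compress y).symm
    exact (((Commute.refl _).smul_left _).add_left ((h y).smul_left _)).add_left
      ((h _).smul_left _)
  · exact (((hv.firstProj_translate x).smul_left _).add_left
      ((hv.compress_translate x y).smul_left _)).add_left ((hv.compress_translate x _).smul_left _)
  · have h : Commute (firstProj v) (hv.compress y') :=
      (hv.firstProj_mul_compress y').trans (hv.compress_mul_firstProj y').symm
    exact ((h.smul_left _).add_left ((hv.compress_comm ht y y').smul_left _)).add_left
      ((hv.compress_comm ht _ y').smul_left _)

theorem IsGNS.component_conj (hv : IsGNS φ v) (ht : IsTrace φ) (y : G₂) (c : ℂ)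
    (k z : G₁ × G₂) : hv.component y c (k * z * k⁻¹) = hv.component y c z := by
  have h : ∀ y : G₂, ⟪v (k * z * k⁻¹)⁻¹, firstProj v (v (1, y))⟫_ℂ =
      ⟪v z⁻¹, firstProj v (v (1, y))⟫_ℂ := fun y => by
    rw [← hv.inner_firstProj_conj ht k z⁻¹, ← hv.firstProj_conj ht k.2 y]
    congr 3
    · group
    · simp [Prod.ext_iff]
  simp only [hv.component_eq, h, ht.central]

end Factor

/-! ### Factorization of characters -/

section Main

variable {G₁ G₂ : Type*} [Group G₁] [Group G₂]

/-- The hard half: a character of the product is the product of its restrictions. The components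
of `φ` cut out by compressions of positive elements of the second factor are multiples of `φ`. -/
theorem eq_tensor_of_mem_Char {φ : G₁ × G₂ → ℂ} (hφ : φ ∈ Char (G₁ × G₂)) :
    φ = tensor (fun x => φ (x, 1)) (fun y => φ (1, y)) := by
  have ht : IsTrace φ := hφ.1
  obtain ⟨H, _, _, _, v, hv⟩ := ht.positiveType.exists_isGNS
  have hval : ∀ (x : G₁) (y : G₂),
      ⟪v (x, (1 : G₂))⁻¹, firstProj v (v (1, y))⟫_ℂ = φ (x, y) := fun x y => by
    have h : ((x, 1)⁻¹ : G₁ × G₂) = (x⁻¹, 1) := by simp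
    rw [h, ← inner_firstProj, firstProj_apply, hv.inner_eq]
    simp
  funext ⟨x, y⟩
  refine (eq_of_forall_fourth_root (p := φ (x, 1)) (w := φ (x, y⁻¹)) (p' := φ (x, 1))
    (w' := φ (x, 1) * φ (1, y⁻¹)) fun c hc => ?_)
  have key := eq_smul_of_mem_Char hφ (r := 4) (hv.isPositiveType_component ht y hc)
    (hv.isPositiveType_component ht y (c := -c) (by simpa using hc))
    (hv.component_conj ht y c) (hv.component_conj ht y (-c))
    (fun g => by simp only [hv.component_eq, map_neg]; ring) (x, 1)
  have h1 : (1 : G₁ × G₂) = (1, 1) := rfl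
  rw [hv.component_eq, hv.component_eq, h1, hval, hval, hval, hval, ← h1, ht.normalized] at key
  rw [key, tensor]
  ring

end Main

end GroupTrace

theorem mainTheorem8 (G₁ G₂ : Type*) [Group G₁] [Group G₂] :
    GroupTrace.Char (G₁ × G₂) =
      {φ : G₁ × G₂ → ℂ | ∃ φ₁ ∈ GroupTrace.Char G₁, ∃ φ₂ ∈ GroupTrace.Char G₂,
        φ = GroupTrace.tensor φ₁ φ₂} := by
  ext φ
  constructor
  · intro h
    have ht : GroupTrace.IsTrace φ := h.1
    have heq := GroupTrace.eq_tensor_of_mem_Char h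
    rw [heq] at h
    exact ⟨_, GroupTrace.left_mem_Char_of_tensor ht.comp_inl ht.comp_inr h,
      _, GroupTrace.right_mem_Char_of_tensor ht.comp_inl ht.comp_inr h, heq⟩
  · rintro ⟨φ₁, h₁, φ₂, h₂, rfl⟩
    exact GroupTrace.tensor_mem_Char h₁ h₂
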